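/- Let $n$ and $q$ be positive integers with $n$ odd and $n\mid q$. Consider the vector configuration $A=A_{n-1}=\{e_i-e_j : 1\le i<j\le n\}$ of positive roots in the weight lattice $\Lambda_W=\mathbb{Z}\{e_1,\dots,e_n\}/(e_1+\cdots+e_n=0)$, which is a lattice of rank $n-1$ in the real vector space $\mathbb{R}^n/(e_1+\cdots+e_n=0)$. For $B\subseteq A$ let $r(B)=\dim_{\mathbb{R}}\operatorname{span}B$ and let $m(B)=[\operatorname{span}B\cap\Lambda_W:\mathbb{Z}B]$. Let $$M^W_{A_{n-1}}(x,y)=\sum_{B\subseteq A} m(B)\,(x-1)^{r(A)-r(B)}(y-1)^{|B|-r(B)}$$ be the arithmetic Tutte polynomial of $A$ in $\Lambda_W$, and let $$\chi^W_{A_{n-1}}(t)=(-1)^{r}\,t^{d-r}\,M^W_{A_{n-1}}(1-t,0),\qquad r=r(A),\quad d=\operatorname{rank}\Lambda_W,$$ be its arithmetic characteristic polynomial (here $d=r=n-1$). Then $\chi^W_{A_{n-1}}(q)/n!$ equals the number of cyclic necklaces, counted up to rotation only, with $n$ black beads and $q-n$ white beads. -/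

import Mathlib

open Polynomial

noncomputable section

namespace ArithTutte

section General

variable {V ι : Type*} [AddCommGroup V] [Module ℝ V]

/-- The rank `r(B) = dim span B` of a subset `B` of a vector configuration `A = (A i)_{i ∈ ι}`. -/
def rank (A : ι → V) (B : Finset ι) : ℕ :=
  Module.finrank ℝ (Submodule.span ℝ (A '' (B : Set ι)))

/-- The multiplicity `m(B) = [span B ∩ Λ : ℤB]`. -/
def latticeMultiplicity (L : AddSubgroup V) (A : ι → V) (B : Finset ι) : ℕ :=
  (AddSubgroup.closure (A '' (B : Set ι))).relIndex
    ((Submodule.span ℝ (A '' (B : Set ι))).toAddSubgroup ⊓ L)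

/-- The arithmetic Tutte polynomial
`M(x, y) = ∑_{B ⊆ A} m(B) (x - 1)^(r(A) - r(B)) (y - 1)^(|B| - r(B))` of a finite vector
configuration `A` in the lattice `L`, with `x = X 0` and `y = X 1`. -/
def arithmeticTutte [Fintype ι] (L : AddSubgroup V) (A : ι → V) : MvPolynomial (Fin 2) ℤ :=
  ∑ B : Finset ι, MvPolynomial.C (latticeMultiplicity L A B : ℤ) *
    (MvPolynomial.X 0 - 1) ^ (rank A Finset.univ - rank A B) *
    (MvPolynomial.X 1 - 1) ^ (B.card - rank A B)

/-- The arithmetic characteristic polynomial `χ(q) = (-1)^r q^(d - r) M(1 - q, 0)`, where `d` is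
the rank of the lattice `L` and `r` is the rank of the configuration `A`. -/
def arithmeticCharPoly [Fintype ι] (L : AddSubgroup V) (A : ι → V) : ℤ[X] :=
  (-1) ^ rank A Finset.univ * X ^ (Module.finrank ℤ L - rank A Finset.univ) *
    MvPolynomial.aeval ![1 - X, 0] (arithmeticTutte L A)

end General

/-- The real vector space `ℝ^n / (e_1 + ⋯ + e_n = 0)`. -/
abbrev TypeASpace (n : ℕ) : Type :=
  (Fin n → ℝ) ⧸ Submodule.span ℝ {(1 : Fin n → ℝ)}

/-- The class of the standard basis vector `e_i` in `ℝ^n / (e_1 + ⋯ + e_n = 0)`. -/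
def basisVec (n : ℕ) (i : Fin n) : TypeASpace n :=
  Submodule.Quotient.mk (Pi.single i 1)

/-- The weight lattice `Λ_W(A_{n-1}) = ℤ{e_1, …, e_n} / (e_1 + ⋯ + e_n = 0)`. -/
def weightLatticeA (n : ℕ) : AddSubgroup (TypeASpace n) :=
  AddSubgroup.closure (Set.range (basisVec n))

/-- The configuration `A_{n-1} = {e_i - e_j : i < j}` of positive roots (these vectors are pairwise
distinct, so the family indexed by the pairs `i < j` is the same as the set). -/
def positiveRootsA (n : ℕ) (p : {p : Fin n × Fin n // p.1 < p.2}) : TypeASpace n :=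
  basisVec n p.1.1 - basisVec n p.1.2

/-- The polynomial `χ^W_{A_{n-1}}`. -/
def charPolyWeightA (n : ℕ) : ℤ[X] :=
  arithmeticCharPoly (weightLatticeA n) (positiveRootsA n)

/-- The set of cyclic necklaces (up to rotation, not reflection) with `b` black beads (`true`) and
`w` white beads (`false`). -/
def necklaces (b w : ℕ) : Set (Cycle Bool) :=
  {c | c.toMultiset.count true = b ∧ c.toMultiset.count false = w}

end ArithTutte

end

/-!
Since `n ∣ q`, the torsion of every quotient `Λ_W / ℤB` is killed by `q`, so `m(B) q^(d - r(B))`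
counts the homomorphisms `Λ_W → ℤ/q` vanishing on `B`. Inclusion-exclusion over `B ⊆ A` then shows
that `χ(q)` counts the homomorphisms vanishing on no root, that is, the injective tuples
`x : {1, …, n} → ℤ/q` with `∑ x_i = 0`: it is `n!` times the number of zero-sum `n`-subsets
of `ℤ/q`.

Necklaces are the rotation orbits of all `n`-subsets of `ℤ/q`. In any finite abelian group `G` and
for `n` odd, there are as many zero-sum `n`-subsets as translation orbits of `n`-subsets. By Fourier
inversion, `|G|` times the former is the sum over the characters `ψ` of the `n`-th coefficient of
`∏ (1 + ψ(g) X) = (1 - (-X)^d)^(|G| / d)`, where `d` is the order of `ψ`. By Burnside's lemma, `|G|`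
times the latter is the sum over `t ∈ G` of the number of `n`-subsets which are unions of cosets of
`⟨t⟩`, which is the `n`-th coefficient of `(1 + X^d)^(|G| / d)`, where `d` is the order of `t`. The
coefficients agree since `n` is odd, and `G` has as many characters as elements of each order.
-/

noncomputable section

namespace ArithTutte

open Finset
open scoped Pointwise

section DualGroup

theorem hasEnoughRootsOfUnity_multiplicative_zmod (q : ℕ) [NeZero q] :
    HasEnoughRootsOfUnity (Multiplicative (ZMod q)) q where
  prim := ⟨Multiplicative.ofAdd 1, by
    have := IsPrimitiveRoot.orderOf (Multiplicative.ofAdd (1 : ZMod q))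
    rwa [orderOf_ofAdd_eq_addOrderOf, ZMod.addOrderOf_one] at this⟩
  cyc := by
    have := isCyclic_of_surjective (toUnits (G := Multiplicative (ZMod q))) toUnits.surjective
    infer_instance

theorem card_addMonoidHom_zmod_of_finite {T : Type*} [AddCommGroup T] [Finite T] {q : ℕ} [NeZero q]
    (hT : ∀ t : T, q • t = 0) : Nat.card (T →+ ZMod q) = Nat.card T := by
  have exponent_dvd : Monoid.exponent (Multiplicative T) ∣ q :=
    Monoid.exponent_dvd_of_forall_pow_eq_one fun t => hT t.toAdd
  have := hasEnoughRootsOfUnity_multiplicative_zmod q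
  have := HasEnoughRootsOfUnity.of_dvd (Multiplicative (ZMod q)) exponent_dvd
  rw [Nat.card_congr AddMonoidHom.toMultiplicative,
    Nat.card_congr (MonoidHom.toHomUnitsMulEquiv (G := Multiplicative T)).toEquiv]
  exact CommGroup.card_monoidHom_of_hasEnoughRootsOfUnity (Multiplicative T) _

theorem card_addMonoidHom_zmod_of_free {F : Type*} [AddCommGroup F] [Module.Finite ℤ F]
    [Module.Free ℤ F] (q : ℕ) : Nat.card (F →+ ZMod q) = q ^ Module.finrank ℤ F := by
  let b := Module.finBasis ℤ F
  rw [Nat.card_congr (addMonoidHomLequivInt (A := F) (B := ZMod q) ℤ).toEquiv,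
    Nat.card_congr (b.constr ℤ).symm.toEquiv, Nat.card_fun, Nat.card_zmod, Nat.card_fin]

theorem card_addMonoidHom_zmod {M : Type*} [AddCommGroup M] [Module.Finite ℤ M] {q : ℕ} [NeZero q]
    (hq : ∀ x ∈ Submodule.torsion ℤ M, q • x = 0) :
    Nat.card (M →+ ZMod q) =
      Nat.card (Submodule.torsion ℤ M) * q ^ Module.finrank ℤ M := by
  let T := Submodule.torsion ℤ M
  obtain ⟨f, hf⟩ := Module.projective_lifting_property _ LinearMap.id T.mkQ_surjective
  let e : (T × (M ⧸ T)) ≃ₗ[ℤ] M := lequivProdOfRightSplitExact T.injective_subtype (by simp) hf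
  have : Finite T := Module.finite_of_fg_torsion T Submodule.torsion_isTorsion
  have card_hom_torsion : Nat.card (T →+ ZMod q) = Nat.card T :=
    card_addMonoidHom_zmod_of_finite fun t => Subtype.ext (hq t t.2)
  have finrank_quotient : Module.finrank ℤ (M ⧸ T) = Module.finrank ℤ M :=
    finrank_quotient_eq_of_le_torsion le_rfl
  rw [← card_hom_torsion, ← finrank_quotient, ← card_addMonoidHom_zmod_of_free, ← Nat.card_prod]
  exact Nat.card_congr <| calc
    (M →+ ZMod q) ≃ (T × (M ⧸ T) →+ ZMod q) := e.symm.toAddEquiv.addMonoidHomCongrLeftEquiv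
    _ ≃ (T →+ ZMod q) × (M ⧸ T →+ ZMod q) :=
      (addMonoidHomLequivInt ℤ).toEquiv.trans <| (LinearMap.coprodEquiv ℤ).symm.toEquiv.trans <|
        ((addMonoidHomLequivInt ℤ).prodCongr (addMonoidHomLequivInt ℤ)).symm.toEquiv

end DualGroup

section FiniteField

variable {V ι : Type*}

theorem rank_le_card [AddCommGroup V] [Module ℝ V] (A : ι → V) (B : Finset ι) :
    rank A B ≤ #B := by
  classical
  rw [rank, ← coe_image]
  exact (finrank_span_finset_le_card _).trans card_image_le

theorem rank_mono [AddCommGroup V] [Module ℝ V] [FiniteDimensional ℝ V] (A : ι → V) :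
    Monotone (rank A) := fun _ _ hBC =>
  Submodule.finrank_mono (Submodule.span_mono (Set.image_mono hBC))

theorem closure_image_le [AddCommGroup V] {L : AddSubgroup V} {A : ι → V} (hA : ∀ i, A i ∈ L)
    (B : Finset ι) : AddSubgroup.closure (A '' (B : Set ι)) ≤ L := by
  rw [AddSubgroup.closure_le]
  rintro _ ⟨i, -, rfl⟩
  exact hA i

section Torsion

variable [AddCommGroup V] {L : AddSubgroup V} {A : ι → V} {q : ℕ}

/-- The sublattice `ℤB` of `L`; homomorphisms from `L ⧸ ℤB` are those from `L` vanishing on `B`. -/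
abbrev relationLattice (L : AddSubgroup V) (A : ι → V) (B : Finset ι) : Submodule ℤ L :=
  AddSubgroup.toIntSubmodule ((AddSubgroup.closure (A '' (B : Set ι))).addSubgroupOf L)

theorem ker_mkQ_relationLattice (B : Finset ι) :
    (relationLattice L A B).mkQ.toAddMonoidHom.ker =
      (AddSubgroup.closure (A '' (B : Set ι))).addSubgroupOf L := by
  ext v
  exact Submodule.Quotient.mk_eq_zero _

theorem forall_vanish_iff_le_ker (hA : ∀ i, A i ∈ L) (B : Finset ι) {M : Type*} [AddCommGroup M]
    (φ : L →+ M) :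
    (∀ i ∈ B, φ ⟨A i, hA i⟩ = 0) ↔ (relationLattice L A B).mkQ.toAddMonoidHom.ker ≤ φ.ker := by
  rw [ker_mkQ_relationLattice]
  constructor
  · intro h v hv
    have closure_le : AddSubgroup.closure (A '' (B : Set ι)) ≤ φ.ker.map L.subtype := by
      rw [AddSubgroup.closure_le]
      rintro _ ⟨i, hi, rfl⟩
      exact ⟨⟨A i, hA i⟩, h i hi, rfl⟩
    obtain ⟨w, hw, hwv⟩ := closure_le hv
    rwa [← Subtype.ext hwv]
  · intro h i hi
    exact h (AddSubgroup.subset_closure ⟨i, hi, rfl⟩)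

variable [Module ℝ V]

/-- `q` annihilates the torsion of `L ⧸ ℤB` for every `B ⊆ A`; the lattice points of `span B` are
exactly those with torsion class. -/
def KillsTorsion (q : ℕ) (L : AddSubgroup V) (A : ι → V) : Prop :=
  ∀ B : Finset ι, ∀ v ∈ L, v ∈ Submodule.span ℝ (A '' (B : Set ι)) →
    q • v ∈ AddSubgroup.closure (A '' (B : Set ι))

variable [NeZero q]

theorem mk_mem_torsion_iff (hq : KillsTorsion q L A) (B : Finset ι) (v : L) :
    (relationLattice L A B).mkQ v ∈ Submodule.torsion ℤ (L ⧸ relationLattice L A B) ↔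
      (v : V) ∈ Submodule.span ℝ (A '' (B : Set ι)) := by
  constructor
  · rintro ⟨⟨m, hm⟩, hmv⟩
    have hm0 : (m : ℝ) ≠ 0 := Int.cast_ne_zero.2 (nonZeroDivisors.ne_zero hm)
    have smul_mem : m • (v : V) ∈ AddSubgroup.closure (A '' (B : Set ι)) := by
      rw [Submonoid.mk_smul, ← map_smul, Submodule.mkQ_apply, Submodule.Quotient.mk_eq_zero] at hmv
      exact hmv
    have closure_le : AddSubgroup.closure (A '' (B : Set ι)) ≤
        (Submodule.span ℝ (A '' (B : Set ι))).toAddSubgroup :=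
      (AddSubgroup.closure_le _).2 Submodule.subset_span
    have := closure_le smul_mem
    rw [← Int.cast_smul_eq_zsmul ℝ] at this
    exact (Submodule.smul_mem_iff _ hm0).1 this
  · intro hv
    refine ⟨⟨q, mem_nonZeroDivisors_of_ne_zero (by simp [NeZero.ne q])⟩, ?_⟩
    rw [Submonoid.mk_smul, ← map_smul, Submodule.mkQ_apply, Submodule.Quotient.mk_eq_zero]
    simpa using! hq B v v.2 hv

theorem card_torsion_eq_latticeMultiplicity (hq : KillsTorsion q L A) (B : Finset ι) :
    Nat.card (Submodule.torsion ℤ (L ⧸ relationLattice L A B)) = latticeMultiplicity L A B := by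
  let W := (Submodule.span ℝ (A '' (B : Set ι))).toAddSubgroup
  let π := (relationLattice L A B).mkQ.toAddMonoidHom
  have torsion_eq : (Submodule.torsion ℤ (L ⧸ relationLattice L A B)).toAddSubgroup =
      (W.addSubgroupOf L).map π := by
    have comap_eq : (Submodule.torsion ℤ (L ⧸ relationLattice L A B)).toAddSubgroup.comap π =
        W.addSubgroupOf L := by
      ext v
      exact mk_mem_torsion_iff hq B v
    rw [← comap_eq, AddSubgroup.map_comap_eq_self_of_surjective]
    exact (relationLattice L A B).mkQ_surjective
  have card_map := AddSubgroup.relIndex_ker (W.addSubgroupOf L) π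
  rw [← torsion_eq, ker_mkQ_relationLattice, AddSubgroup.addSubgroupOf,
    AddSubgroup.relIndex_comap, AddSubgroup.addSubgroupOf_map_subtype] at card_map
  exact card_map.symm

theorem smul_eq_zero_of_mem_torsion (hq : KillsTorsion q L A) (B : Finset ι)
    {x : L ⧸ relationLattice L A B} (hx : x ∈ Submodule.torsion ℤ (L ⧸ relationLattice L A B)) :
    q • x = 0 := by
  obtain ⟨v, rfl⟩ := (relationLattice L A B).mkQ_surjective x
  have hv := hq B v v.2 ((mk_mem_torsion_iff hq B v).1 hx)
  rw [← map_nsmul, Submodule.mkQ_apply, Submodule.Quotient.mk_eq_zero]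
  exact hv

end Torsion

variable [NormedAddCommGroup V] [NormedSpace ℝ V] [FiniteDimensional ℝ V] {L : AddSubgroup V}
  [DiscreteTopology L] {A : ι → V}

instance finite_of_discrete : Module.Finite ℤ L :=
  have : DiscreteTopology (AddSubgroup.toIntSubmodule L) := ‹_›
  inferInstanceAs (Module.Finite ℤ (AddSubgroup.toIntSubmodule L))

theorem finrank_closure_eq_rank (hA : ∀ i, A i ∈ L) (B : Finset ι) :
    Module.finrank ℤ (AddSubgroup.closure (A '' (B : Set ι))) = rank A B := by
  have span_discrete : DiscreteTopology (Submodule.span ℤ (A '' (B : Set ι))) := by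
    refine DiscreteTopology.of_subset (s := (L : Set V)) ‹_› ?_
    rw [← Submodule.coe_toAddSubgroup, Submodule.span_int_eq_addSubgroupClosure]
    exact closure_image_le hA B
  rw [rank, ← Set.finrank, Real.finrank_eq_int_finrank_of_discrete span_discrete, Set.finrank,
    ← Submodule.span_int_eq_addSubgroupClosure]
  rfl

theorem rank_le_finrank_lattice (hA : ∀ i, A i ∈ L) (B : Finset ι) :
    rank A B ≤ Module.finrank ℤ L := by
  have closure_le := closure_image_le hA B
  rw [← finrank_closure_eq_rank hA]
  exact LinearMap.finrank_le_finrank_of_injective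
    (f := (AddSubgroup.inclusion closure_le).toIntLinearMap)
    (AddSubgroup.inclusion_injective closure_le)

theorem finrank_quotient_relationLattice (hA : ∀ i, A i ∈ L) (B : Finset ι) :
    Module.finrank ℤ (L ⧸ relationLattice L A B) = Module.finrank ℤ L - rank A B := by
  have finrank_relations : Module.finrank ℤ (relationLattice L A B) = rank A B := by
    rw [← finrank_closure_eq_rank hA B]
    exact (AddSubgroup.addSubgroupOfEquivOfLe (closure_image_le hA B)).toIntLinearEquiv.finrank_eq
  rw [← (relationLattice L A B).finrank_quotient_add_finrank, finrank_relations,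
    Nat.add_sub_cancel]

theorem card_hom_vanishing {q : ℕ} [NeZero q] (hA : ∀ i, A i ∈ L) (hq : KillsTorsion q L A)
    (B : Finset ι) :
    Nat.card {φ : L →+ ZMod q // ∀ i ∈ B, φ ⟨A i, hA i⟩ = 0} =
      latticeMultiplicity L A B * q ^ (Module.finrank ℤ L - rank A B) := by
  let homEquiv : {φ : L →+ ZMod q // ∀ i ∈ B, φ ⟨A i, hA i⟩ = 0} ≃
      (L ⧸ relationLattice L A B →+ ZMod q) :=
    (Equiv.subtypeEquivRight (forall_vanish_iff_le_ker hA B)).trans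
      (AddMonoidHom.liftOfSurjective (relationLattice L A B).mkQ.toAddMonoidHom
        (relationLattice L A B).mkQ_surjective)
  rw [Nat.card_congr homEquiv,
    card_addMonoidHom_zmod fun _ => smul_eq_zero_of_mem_torsion hq B,
    card_torsion_eq_latticeMultiplicity hq, finrank_quotient_relationLattice hA]

theorem eval_arithmeticCharPoly [Fintype ι] (hA : ∀ i, A i ∈ L) (t : ℤ) :
    (arithmeticCharPoly L A).eval t = ∑ B : Finset ι, (-1) ^ #B *
      (latticeMultiplicity L A B * t ^ (Module.finrank ℤ L - rank A B)) := by
  simp only [arithmeticCharPoly, arithmeticTutte, map_sum, map_mul, map_pow, map_sub, map_one,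
    map_natCast, MvPolynomial.aeval_X, eval_mul, eval_finsetSum, eval_pow, eval_neg,
    eval_one, mul_sum, Matrix.cons_val_zero, Matrix.cons_val_one, eval_sub, eval_X, eval_zero,
    eval_natCast]
  refine sum_congr rfl fun B _ => ?_
  obtain ⟨a, ha⟩ := Nat.exists_eq_add_of_le (rank_mono A (subset_univ B))
  obtain ⟨b, hb⟩ := Nat.exists_eq_add_of_le (rank_le_card A B)
  obtain ⟨c, hc⟩ := Nat.exists_eq_add_of_le (rank_le_finrank_lattice hA univ)
  have corank_eq : Module.finrank ℤ L - rank A B = a + c := by omega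
  rw [corank_eq, hc, hb, ha, Nat.add_sub_cancel_left, Nat.add_sub_cancel_left,
    Nat.add_sub_cancel_left, show 1 - t - 1 = -1 * t by ring, mul_pow]
  have sign_eq : (-1 : ℤ) ^ (rank A B + a) * ((-1) ^ a * (0 - 1) ^ b) = (-1) ^ (rank A B + b) := by
    rw [zero_sub, pow_add, pow_add, mul_assoc, ← mul_assoc ((-1) ^ a), ← mul_pow]
    norm_num
  rw [← sign_eq]
  ring

/-- The finite field method, with `L →+ ZMod q` the `ZMod q`-points of the torus dual to `L`. -/
theorem eval_arithmeticCharPoly_eq_card [Fintype ι] {q : ℕ} [NeZero q] (hA : ∀ i, A i ∈ L)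
    (hq : KillsTorsion q L A) :
    (arithmeticCharPoly L A).eval (q : ℤ) =
      Nat.card {φ : L →+ ZMod q // ∀ i, φ ⟨A i, hA i⟩ ≠ 0} := by
  classical
  have : Finite (L →+ ZMod q) := by
    have : DiscreteTopology (AddSubgroup.toIntSubmodule L) := ‹_›
    have : Module.Free ℤ L :=
      inferInstanceAs (Module.Free ℤ (AddSubgroup.toIntSubmodule L))
    refine Nat.finite_of_card_ne_zero ?_
    rw [card_addMonoidHom_zmod_of_free]
    exact pow_ne_zero _ (NeZero.ne q)
  have := Fintype.ofFinite (L →+ ZMod q)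
  let vanishing (i : ι) : Finset (L →+ ZMod q) := {φ | φ ⟨A i, hA i⟩ = 0}
  calc (arithmeticCharPoly L A).eval (q : ℤ)
      = ∑ B ∈ (univ : Finset ι).powerset, (-1) ^ #B * (#(B.inf vanishing) : ℤ) := by
        rw [eval_arithmeticCharPoly hA, powerset_univ]
        refine sum_congr rfl fun B _ => ?_
        rw [← Nat.cast_pow, ← Nat.cast_mul, ← card_hom_vanishing hA hq B, Nat.card_eq_fintype_card,
          Fintype.card_subtype]
        congr 3
        ext φ
        simp [vanishing, mem_inf]
    _ = #(univ.inf fun i => (vanishing i)ᶜ) := (inclusion_exclusion_card_inf_compl _ _).symm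
    _ = Nat.card {φ : L →+ ZMod q // ∀ i, φ ⟨A i, hA i⟩ ≠ 0} := by
        rw [Nat.card_eq_fintype_card, Fintype.card_subtype]
        congr 2
        ext φ
        simp [vanishing, mem_inf]

end FiniteField

section TypeA

/-- The vector `e_i - e_j` of `R^α`, for `p = (i, j)`. -/
def rootVec (R : Type*) [CommRing R] {α : Type*} [DecidableEq α] (p : α × α) : α → R :=
  Pi.single p.1 1 - Pi.single p.2 1

theorem mem_span_rootVec_iff {R α : Type*} [CommRing R] [Fintype α] [DecidableEq α]
    {s : Set (α × α)} {x : α → R} :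
    x ∈ Submodule.span R (rootVec R '' s) ↔
      ∀ f : α → R, (∀ p ∈ s, f p.1 = f p.2) → f ⬝ᵥ x = 0 := by
  set S := Submodule.span R (rootVec R '' s)
  constructor
  · intro hx f hf
    have span_le : S ≤ LinearMap.ker (dotProductBilin R R f) := by
      rw [Submodule.span_le]
      rintro _ ⟨p, hp, rfl⟩
      simp [rootVec, dotProduct_sub, hf p hp]
    exact span_le hx
  · intro hx
    let sameClass : Setoid α :=
      { r := fun i j => (Pi.single i 1 - Pi.single j 1 : α → R) ∈ S
        iseqv :=
          { refl := fun i => by simp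
            symm := fun h => by simpa using S.neg_mem h
            trans := fun h h' => by simpa using S.add_mem h h' } }
    let rep (i : α) : α := (Quotient.mk sameClass i).out
    have single_sub_rep_mem (i : α) : (Pi.single i 1 - Pi.single (rep i) 1 : α → R) ∈ S :=
      sameClass.symm (Quotient.mk_out i)
    have sum_rep_eq_zero : ∑ i, x i • (Pi.single (rep i) 1 : α → R) = 0 := by
      ext c
      have h := hx (fun i => (Pi.single (rep i) 1 : α → R) c) fun p hp => by
        have : rep p.1 = rep p.2 :=
          congrArg Quotient.out (Quotient.sound (Submodule.subset_span ⟨p, hp, rfl⟩))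
        rw [this]
      simpa [dotProduct, mul_comm] using h
    have x_eq : x = ∑ i, x i • (Pi.single i 1 - Pi.single (rep i) 1 : α → R) := by
      simp only [smul_sub, sum_sub_distrib]
      rw [sum_rep_eq_zero, sub_zero]
      exact pi_eq_sum_univ' x
    rw [x_eq]
    exact S.sum_mem fun i _ => S.smul_mem _ (single_sub_rep_mem i)

theorem card_smul_sub_sum_mem_span {α : Type*} [Fintype α] [DecidableEq α] {s : Set (α × α)}
    {z : α → ℤ} {y : α → ℝ} {c : ℝ}
    (hy : y ∈ Submodule.span ℝ (rootVec ℝ '' s))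
    (hz : (fun i => (z i : ℝ)) = y + fun _ => c) :
    (Fintype.card α • z - fun _ => ∑ i, z i) ∈ Submodule.span ℤ (rootVec ℤ '' s) := by
  -- The same equations cut out the span over every ring, so membership descends from `ℝ` to `ℤ`.
  rw [mem_span_rootVec_iff] at hy ⊢
  have sum_mul (g : α → ℝ) (hg : ∀ p ∈ s, g p.1 = g p.2) :
      ∑ i, g i * z i = c * ∑ i, g i := by
    have h : g ⬝ᵥ (fun i => (z i : ℝ)) = g ⬝ᵥ fun _ => c := by
      rw [hz, dotProduct_add, hy g hg, zero_add]
    simpa only [dotProduct, ← Finset.sum_mul, mul_comm c] using h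
  intro f hf
  have sum_mul_f := sum_mul (fun i => f i) fun p hp => congrArg _ (hf p hp)
  have sum_z : ∑ i, (z i : ℝ) = c * Fintype.card α := by
    simpa using sum_mul 1 fun _ _ => rfl
  have h : (∑ i, f i * (Fintype.card α * z i - ∑ j, (z j : ℝ)) : ℝ) = 0 := calc
    _ = Fintype.card α * ∑ i, f i * (z i : ℝ) - (∑ i, (f i : ℝ)) * ∑ j, (z j : ℝ) := by
      simp only [mul_sub, sum_sub_distrib, ← Finset.sum_mul, ← mul_sum,
        mul_left_comm _ (Fintype.card α : ℝ)]
    _ = 0 := by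
      rw [sum_mul_f, sum_z]
      ring
  have h' : ∑ i, f i * (Fintype.card α * z i - ∑ j, z j) = 0 := by exact_mod_cast h
  simpa [dotProduct] using h'

variable {n : ℕ}

theorem mk_eq_sum_smul_basisVec (y : Fin n → ℝ) :
    (Submodule.Quotient.mk y : TypeASpace n) = ∑ i, y i • basisVec n i := by
  conv_lhs => rw [pi_eq_sum_univ' y]
  simp only [← Submodule.mkQ_apply, map_sum, map_smul, basisVec]

theorem mk_eq_mk_iff {y z : Fin n → ℝ} :
    (Submodule.Quotient.mk y : TypeASpace n) = Submodule.Quotient.mk z ↔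
      ∃ c : ℝ, y = z + fun _ => c := by
  rw [Submodule.Quotient.eq, Submodule.mem_span_singleton]
  refine exists_congr fun c => ?_
  rw [eq_comm, sub_eq_iff_eq_add']
  congr!
  simp

/-- The class of `e_i` as an element of the weight lattice. -/
def weightVec (n : ℕ) (i : Fin n) : weightLatticeA n :=
  ⟨basisVec n i, AddSubgroup.subset_closure ⟨i, rfl⟩⟩

/-- The projection `ℤ^n → Λ_W`. -/
def weightProj (n : ℕ) : (Fin n → ℤ) →ₗ[ℤ] weightLatticeA n :=
  Fintype.linearCombination ℤ (weightVec n)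

theorem coe_weightProj (z : Fin n → ℤ) :
    (weightProj n z : TypeASpace n) = Submodule.Quotient.mk (fun i => (z i : ℝ)) := by
  rw [mk_eq_sum_smul_basisVec]
  simp [weightProj, Fintype.linearCombination_apply, weightVec, Int.cast_smul_eq_zsmul]

theorem weightProj_single (i : Fin n) : weightProj n (Pi.single i 1) = weightVec n i := by
  simp [weightProj]

theorem weightProj_const (m : ℤ) : weightProj n (fun _ => m) = 0 := by
  rw [Subtype.ext_iff, coe_weightProj, AddSubgroup.coe_zero, ← Submodule.Quotient.mk_zero,
    mk_eq_mk_iff]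
  exact ⟨m, by simp⟩

theorem weightProj_surjective (n : ℕ) : Function.Surjective (weightProj n) := by
  have preimage_eq : ((↑) : weightLatticeA n → TypeASpace n) ⁻¹' Set.range (basisVec n) =
      Set.range (weightVec n) := by
    ext v
    simp [weightVec, Subtype.ext_iff]
  have closure_eq_top : AddSubgroup.closure (Set.range (weightVec n)) = ⊤ := by
    rw [← preimage_eq]
    exact AddSubgroup.closure_closure_coe_preimage
  rw [← LinearMap.range_eq_top, weightProj, Fintype.range_linearCombination,
    ← Submodule.toAddSubgroup_inj, Submodule.span_int_eq_addSubgroupClosure, closure_eq_top]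
  rfl

theorem eq_const_of_weightProj_eq_zero {z : Fin n → ℤ} (hz : weightProj n z = 0) (i j : Fin n) :
    z i = z j := by
  rw [Subtype.ext_iff, coe_weightProj, AddSubgroup.coe_zero, ← Submodule.Quotient.mk_zero,
    mk_eq_mk_iff] at hz
  obtain ⟨c, hc⟩ := hz
  have := (congrFun hc i).trans (congrFun hc j).symm
  exact_mod_cast this

theorem positiveRootsA_mem (p : {p : Fin n × Fin n // p.1 < p.2}) :
    positiveRootsA n p ∈ weightLatticeA n :=
  sub_mem (weightVec n p.1.1).2 (weightVec n p.1.2).2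

variable (B : Set {p : Fin n × Fin n // p.1 < p.2})

theorem image_positiveRootsA_eq_mkQ : positiveRootsA n '' B =
    Submodule.mkQ (Submodule.span ℝ {(1 : Fin n → ℝ)}) '' (rootVec ℝ '' (Subtype.val '' B)) := by
  simp only [Set.image_image, rootVec, map_sub]
  rfl

theorem image_positiveRootsA_eq_weightProj : positiveRootsA n '' B =
    ((weightLatticeA n).subtype.toIntLinearMap ∘ₗ weightProj n) ''
      (rootVec ℤ '' (Subtype.val '' B)) := by
  simp only [Set.image_image, rootVec, map_sub, LinearMap.comp_apply, weightProj_single]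
  rfl

theorem smul_mem_closure_image_positiveRootsA {v : TypeASpace n} (hvL : v ∈ weightLatticeA n)
    (hv : v ∈ Submodule.span ℝ (positiveRootsA n '' B)) :
    n • v ∈ AddSubgroup.closure (positiveRootsA n '' B) := by
  obtain ⟨z, hz⟩ := weightProj_surjective n ⟨v, hvL⟩
  have coe_z : (weightProj n z : TypeASpace n) = v := congrArg Subtype.val hz
  rw [image_positiveRootsA_eq_mkQ, ← Submodule.map_span] at hv
  obtain ⟨y, hy, hyv⟩ := hv
  obtain ⟨c, hc⟩ := mk_eq_mk_iff.1 ((coe_weightProj z).symm.trans (coe_z.trans hyv.symm))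
  let w : Fin n → ℤ := n • z - fun _ => ∑ i, z i
  have w_mem : w ∈ Submodule.span ℤ (rootVec ℤ '' (Subtype.val '' B)) := by
    simpa [w] using card_smul_sub_sum_mem_span hy hc
  have proj_w : (weightProj n w : TypeASpace n) = n • v := by
    rw [map_sub, weightProj_const, sub_zero, map_nsmul, AddSubgroup.coe_nsmul, coe_z]
  rw [image_positiveRootsA_eq_weightProj, ← Submodule.span_int_eq_addSubgroupClosure,
    ← Submodule.map_span, ← proj_w]
  exact Submodule.mem_map_of_mem w_mem

theorem killsTorsion_positiveRootsA {q : ℕ} (hnq : n ∣ q) :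
    KillsTorsion q (weightLatticeA n) (positiveRootsA n) := by
  rintro B v hvL hv
  obtain ⟨k, rfl⟩ := hnq
  rw [mul_comm, mul_smul]
  exact nsmul_mem (smul_mem_closure_image_positiveRootsA _ hvL hv) k

instance isClosed_span_one :
    IsClosed (Submodule.span ℝ {(1 : Fin n → ℝ)} : Set (Fin n → ℝ)) :=
  Submodule.closed_of_finiteDimensional _

/-- The map `y ↦ (y_i - y_j)_{i, j}`, an embedding of `ℝ^n / (e_1 + ⋯ + e_n = 0)` sending the weight
lattice to integer vectors. -/
def coordDiff (n : ℕ) : TypeASpace n →ₗ[ℝ] Fin n × Fin n → ℝ :=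
  Submodule.liftQ _
    (LinearMap.funLeft ℝ ℝ Prod.fst - LinearMap.funLeft ℝ ℝ Prod.snd) <| by
    rw [Submodule.span_singleton_le_iff_mem]
    exact funext fun _ => sub_self (1 : ℝ)

theorem coordDiff_mk (y : Fin n → ℝ) (p : Fin n × Fin n) :
    coordDiff n (Submodule.Quotient.mk y) p = y p.1 - y p.2 :=
  rfl

theorem coordDiff_injective (n : ℕ) : Function.Injective (coordDiff n) := by
  rw [← LinearMap.ker_eq_bot, LinearMap.ker_eq_bot']
  intro v hv
  obtain ⟨y, rfl⟩ := Submodule.mkQ_surjective _ v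
  have y_const (i j : Fin n) : y i = y j := sub_eq_zero.1 (congrFun hv (i, j))
  rw [Submodule.mkQ_apply, ← Submodule.Quotient.mk_zero, mk_eq_mk_iff]
  rcases isEmpty_or_nonempty (Fin n) with _ | ⟨⟨j⟩⟩
  · exact ⟨0, Subsingleton.elim _ _⟩
  · exact ⟨y j, funext fun i => by simpa using y_const i j⟩

instance discreteTopology_weightLatticeA (n : ℕ) : DiscreteTopology (weightLatticeA n) := by
  let Z := Submodule.span ℤ (Set.range (Pi.basisFun ℝ (Fin n × Fin n)))
  have discrete_Z : DiscreteTopology Z := inferInstance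
  have discrete_preimage : DiscreteTopology (coordDiff n ⁻¹' (Z : Set (Fin n × Fin n → ℝ))) :=
    @DiscreteTopology.preimage_of_continuous_injective _ _ _ _ _ discrete_Z _
      (LinearMap.continuous_of_finiteDimensional _) (coordDiff_injective n)
  refine DiscreteTopology.of_subset discrete_preimage fun v hv => ?_
  obtain ⟨z, hz⟩ := weightProj_surjective n ⟨v, hv⟩
  rw [Set.mem_preimage, SetLike.mem_coe, Module.Basis.mem_span_iff_repr_mem]
  intro p
  have coe_z : (weightProj n z : TypeASpace n) = v := congrArg Subtype.val hz
  rw [← coe_z, coe_weightProj]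
  exact ⟨z p.1 - z p.2, by simp [coordDiff_mk]⟩

theorem sum_weightVec : ∑ i, weightVec n i = 0 := by
  simpa [weightProj, Fintype.linearCombination_apply] using weightProj_const (n := n) 1

theorem existsUnique_hom_weightVec_eq {M : Type*} [AddCommGroup M] [NeZero n] {x : Fin n → M}
    (hx : ∑ i, x i = 0) : ∃! φ : weightLatticeA n →+ M, ∀ i, φ (weightVec n i) = x i := by
  let π := (weightProj n).toAddMonoidHom
  have π_surjective : Function.Surjective π := weightProj_surjective n
  let f : (Fin n → ℤ) →+ M := (Fintype.linearCombination ℤ x).toAddMonoidHom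
  have f_apply (z : Fin n → ℤ) : f z = ∑ i, z i • x i := Fintype.linearCombination_apply ℤ x z
  have ker_le : π.ker ≤ f.ker := by
    intro z hz
    have z_eq (i : Fin n) : z i = z 0 := eq_const_of_weightProj_eq_zero hz i 0
    rw [AddMonoidHom.mem_ker, f_apply]
    simp only [z_eq, ← smul_sum, hx, smul_zero]
  refine ⟨π.liftOfSurjective π_surjective ⟨f, ker_le⟩, fun i => ?_, fun φ hφ => ?_⟩
  · rw [← weightProj_single]
    refine (π.liftOfRightInverse_comp_apply _ _ ⟨f, ker_le⟩ (Pi.single i 1)).trans ?_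
    exact (Fintype.linearCombination_apply_single ℤ x i 1).trans (one_smul ℤ _)
  · rw [← AddMonoidHom.cancel_right π_surjective]
    refine Eq.trans ?_ (π.liftOfRightInverse_comp _ _ ⟨f, ker_le⟩).symm
    ext z
    simp [π, f_apply, weightProj, Fintype.linearCombination_apply, hφ]

theorem injective_iff_forall_lt_ne {α X : Type*} [LinearOrder α] (x : α → X) :
    Function.Injective x ↔ ∀ p : {p : α × α // p.1 < p.2}, x p.1.1 ≠ x p.1.2 :=
  ⟨fun h p => h.ne p.2.ne, fun h => .of_lt_imp_ne fun i j hij => h ⟨(i, j), hij⟩⟩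

theorem forall_hom_root_ne_zero_iff {M : Type*} [AddCommGroup M] (φ : weightLatticeA n →+ M) :
    (∀ p, φ ⟨positiveRootsA n p, positiveRootsA_mem p⟩ ≠ 0) ↔
      Function.Injective fun i => φ (weightVec n i) := by
  rw [injective_iff_forall_lt_ne]
  refine forall_congr' fun p => ?_
  have map_root : φ ⟨positiveRootsA n p, positiveRootsA_mem p⟩ =
      φ (weightVec n p.1.1) - φ (weightVec n p.1.2) :=
    map_sub φ (weightVec n p.1.1) (weightVec n p.1.2)
  rw [map_root, sub_ne_zero]

theorem card_hom_root_ne_zero (n : ℕ) [NeZero n] (M : Type*) [AddCommGroup M] :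
    Nat.card {φ : weightLatticeA n →+ M // ∀ p, φ ⟨positiveRootsA n p, positiveRootsA_mem p⟩ ≠ 0} =
      Nat.card {x : Fin n ↪ M // ∑ i, x i = 0} := by
  refine Nat.card_eq_of_bijective (fun φ => ⟨⟨fun i => φ.1 (weightVec n i),
    (forall_hom_root_ne_zero_iff φ.1).1 φ.2⟩, ?_⟩) ⟨fun φ ψ h => ?_, fun ⟨x, hx⟩ => ?_⟩
  · simp only [Function.Embedding.coeFn_mk]
    rw [← map_sum, sum_weightVec, map_zero]
  · have sum_eq : ∑ i, ψ.1 (weightVec n i) = 0 := by rw [← map_sum, sum_weightVec, map_zero]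
    refine Subtype.ext ((existsUnique_hom_weightVec_eq sum_eq).unique (fun i => ?_) fun _ => rfl)
    exact DFunLike.congr_fun (congrArg Subtype.val h) i
  · obtain ⟨φ, hφ, -⟩ := existsUnique_hom_weightVec_eq hx
    refine ⟨⟨φ, (forall_hom_root_ne_zero_iff φ).2 ?_⟩, Subtype.ext (DFunLike.ext _ _ hφ)⟩
    rw [funext hφ]
    exact x.injective

theorem card_embedding_image_eq {n : ℕ} {X : Type*} (S : Set.powersetCard X n) :
    Nat.card {x : Fin n ↪ X // Set.powersetCard.ofFinEmb n X x = S} = n.factorial := by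
  have image_eq_iff (x : Fin n ↪ X) :
      Set.powersetCard.ofFinEmb n X x = S ↔ ∀ i, x i ∈ (S.1 : Set X) := by
    simp [Set.powersetCard.eq_iff_subset, subset_iff, Set.powersetCard.mem_coe_iff]
  have card_S : Fintype.card (S.1 : Set X) = n := (Fintype.card_coe S.1).trans S.2
  rw [Nat.card_congr ((Equiv.subtypeEquivRight image_eq_iff).trans
    (Equiv.codRestrict (Fin n) (S.1 : Set X))), Nat.card_eq_fintype_card,
    Fintype.card_embedding_eq, card_S, Fintype.card_fin, Nat.descFactorial_self]

theorem card_embedding_sum_eq_zero (n : ℕ) (M : Type*) [AddCommGroup M] [Finite M] :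
    Nat.card {x : Fin n ↪ M // ∑ i, x i = 0} =
      n.factorial * Nat.card {S : Set.powersetCard M n // ∑ x ∈ S.1, x = 0} := by
  have sum_iff (x : Fin n ↪ M) : ∑ i, x i = 0 ↔
      ∑ m ∈ (Set.powersetCard.ofFinEmb n M x).1, m = 0 := by
    rw [Set.powersetCard.val_ofFinEmb, sum_map]
  have := Fintype.ofFinite {S : Set.powersetCard M n // ∑ x ∈ S.1, x = 0}
  rw [← Nat.card_congr (Equiv.sigmaSubtypeFiberEquivSubtype (Set.powersetCard.ofFinEmb n M)
    (q := fun S => ∑ m ∈ S.1, m = 0) sum_iff), Nat.card_sigma]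
  simp only [card_embedding_image_eq, sum_const, card_univ, smul_eq_mul, mul_comm,
    Nat.card_eq_fintype_card]

end TypeA

/-- The number of `n`-element unions of blocks of a partition of an `N`-element set into blocks of
size `d`. -/
def blockUnionCount (N d n : ℕ) : ℕ :=
  if d ∣ n then (N / d).choose (n / d) else 0

theorem coeff_one_sub_neg_X_pow {R : Type*} [CommRing R] {n d : ℕ} (hn : Odd n) (hd : 0 < d)
    (m : ℕ) :
    ((1 - (-X) ^ d : R[X]) ^ m).coeff n = ((if d ∣ n then m.choose (n / d) else 0 : ℕ) : R) := by
  have expand_eq : (1 - (-X) ^ d : R[X]) ^ m = expand R d ((1 - (-1) ^ d * X) ^ m) := by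
    rw [neg_pow]
    simp
  rw [expand_eq, coeff_expand hd]
  split_ifs with hdn
  · rw [(hn.of_dvd_nat hdn).neg_one_pow, neg_one_mul, sub_neg_eq_add, coeff_one_add_X_pow]
  · rw [Nat.cast_zero]

theorem coeff_prod_one_add_C_mul_X {ι R : Type*} [Fintype ι] [CommSemiring R] (f : ι → R)
    (n : ℕ) :
    (∏ i, (1 + C (f i) * X)).coeff n = ∑ S : Set.powersetCard ι n, ∏ i ∈ S.1, f i := by
  classical
  have coeff_subset (S : Finset ι) :
      (∏ i ∈ S, C (f i) * X).coeff n = if #S = n then ∏ i ∈ S, f i else 0 := by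
    rw [prod_mul_distrib, prod_const, ← map_prod, coeff_C_mul_X_pow]
    simp only [eq_comm]
  rw [prod_one_add, finsetSum_coeff, sum_congr rfl fun S _ => coeff_subset S, ← sum_filter]
  exact Finset.sum_subtype _ (by simp) _

section
variable {H R : Type*} [Group H] [Fintype H]

theorem card_fiber_eq_card_div_card_image [Monoid R] [DecidableEq R] (f : H →* R) {ζ : R}
    (hζ : ζ ∈ univ.image f) : #{h | f h = ζ} = Fintype.card H / #(univ.image f) := by
  have mem_range {ξ : R} (hξ : ξ ∈ univ.image f) : ξ ∈ Set.range f := by simpa using hξ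
  have card_eq : Fintype.card H = #(univ.image f) * #{h | f h = ζ} := by
    rw [← card_univ, card_eq_sum_card_image f univ]
    exact sum_const_nat fun ξ hξ =>
      MonoidHom.card_fiber_eq_of_mem_range f (mem_range hξ) (mem_range hζ)
  rw [card_eq, Nat.mul_div_cancel_left _ (card_pos.2 ⟨ζ, hζ⟩)]

theorem pow_card_image_eq_one [CommMonoid R] [DecidableEq R] (f : H →* R) :
    f ^ #(univ.image f) = 1 := by
  have card_image : #(univ.image f) = f.toHomUnits.ker.index := by
    rw [Subgroup.index_ker, ← Set.ncard_coe_finset, coe_image, coe_univ, Set.image_univ,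
      ← Nat.card_coe_set_eq, ← SetLike.coe_sort_coe, MonoidHom.coe_range,
      ← Nat.card_image_of_injective Units.val_injective, ← Set.range_comp]
    rfl
  ext h
  have := f.toHomUnits.ker.pow_index_mem h
  rw [MonoidHom.mem_ker, map_pow, Units.ext_iff] at this
  simpa [card_image] using this

variable [CommRing R] [IsDomain R]

theorem image_eq_nthRootsFinset_and_card [DecidableEq R] (f : H →* R) :
    univ.image f = nthRootsFinset (orderOf f) 1 ∧ #(univ.image f) = orderOf f := by
  have card_image_pos : 0 < #(univ.image f) := card_pos.2 (univ_nonempty.image f)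
  have hf : 0 < orderOf f :=
    orderOf_pos_iff.2 (isOfFinOrder_iff_pow_eq_one.2 ⟨_, card_image_pos, pow_card_image_eq_one f⟩)
  have image_subset : univ.image f ⊆ nthRootsFinset (orderOf f) 1 := by
    intro ζ hζ
    obtain ⟨h, -, rfl⟩ := mem_image.1 hζ
    rw [mem_nthRootsFinset hf, ← MonoidHom.pow_apply, pow_orderOf_eq_one, MonoidHom.one_apply]
  have card_roots_le : #(nthRootsFinset (orderOf f) (1 : R)) ≤ orderOf f := by
    classical
    rw [nthRootsFinset_def]
    exact (Multiset.toFinset_card_le _).trans (card_nthRoots _ _)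
  have le_card_image : orderOf f ≤ #(univ.image f) :=
    orderOf_le_of_pow_eq_one card_image_pos (pow_card_image_eq_one f)
  exact ⟨eq_of_subset_of_card_le image_subset (card_roots_le.trans le_card_image),
    ((card_le_card image_subset).trans card_roots_le).antisymm le_card_image⟩

theorem prod_comp_monoidHom {M : Type*} [CommMonoid M] (f : H →* R) (F : R → M) :
    ∏ h, F (f h) = (∏ ζ ∈ nthRootsFinset (orderOf f) 1, F ζ) ^ (Fintype.card H / orderOf f) := by
  classical
  obtain ⟨image_eq, card_image_eq⟩ := image_eq_nthRootsFinset_and_card f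
  rw [prod_comp F f, ← image_eq, ← prod_pow]
  refine prod_congr rfl fun ζ hζ => ?_
  rw [card_fiber_eq_card_div_card_image f hζ, card_image_eq]

theorem prod_one_add_C_monoidHom_mul_X (f : H →* R) {ζ : R}
    (hζ : IsPrimitiveRoot ζ (orderOf f)) :
    ∏ h, (1 + C (f h) * X) = (1 - (-X) ^ orderOf f) ^ (Fintype.card H / orderOf f) := by
  classical
  let Cf : H →* R[X] := (C : R →+* R[X]).toMonoidHom.comp f
  have orderOf_Cf : orderOf Cf = orderOf f :=
    orderOf_injective (MonoidHom.compHom (C : R →+* R[X]).toMonoidHom)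
      (fun _ _ h => MonoidHom.ext fun x => C_injective (DFunLike.congr_fun h x)) f
  have orderOf_pos : 0 < orderOf f :=
    (image_eq_nthRootsFinset_and_card f).2 ▸ card_pos.2 (univ_nonempty.image f)
  calc ∏ h, (1 + C (f h) * X) = ∏ h, (1 - Cf h * -X) := by simp [Cf]
    _ = (∏ ξ ∈ nthRootsFinset (orderOf f) 1, (1 - ξ * -X)) ^ (Fintype.card H / orderOf f) := by
      rw [prod_comp_monoidHom Cf (fun ξ => 1 - ξ * -X), orderOf_Cf]
    _ = (1 - (-X) ^ orderOf f) ^ (Fintype.card H / orderOf f) := by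
      rw [← (hζ.map_of_injective C_injective).pow_sub_pow_eq_prod_sub_mul 1 (-X) orderOf_pos,
        one_pow]

end

section
variable {G : Type*} [AddCommGroup G] [Fintype G]

theorem sum_addChar_orderOf {M : Type*} [AddCommMonoid M] (F : ℕ → M) :
    ∑ ψ : AddChar G ℂ, F (orderOf ψ) = ∑ t : G, F (addOrderOf t) := by
  have : NeZero (Monoid.exponent (Multiplicative G)) := ⟨Monoid.exponent_ne_zero_of_finite⟩
  obtain ⟨unitsDual⟩ := CommGroup.monoidHom_mulEquiv_of_hasEnoughRootsOfUnity (Multiplicative G) ℂ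
  let dual : AddChar G ℂ ≃* Multiplicative G :=
    AddChar.toMonoidHomMulEquiv.trans (MonoidHom.toHomUnitsMulEquiv.trans unitsDual)
  refine Fintype.sum_equiv (dual.toEquiv.trans Multiplicative.toAdd) _ _ fun ψ => ?_
  have addOrderOf_eq : addOrderOf (dual ψ).toAdd = orderOf ψ :=
    (orderOf_ofAdd_eq_addOrderOf _).symm.trans (dual.orderOf_eq ψ)
  exact congrArg F addOrderOf_eq.symm

theorem sum_powersetCard_addChar_sum {n : ℕ} (hn : Odd n) (ψ : AddChar G ℂ) :
    ∑ S : Set.powersetCard G n, ψ (∑ x ∈ S.1, x) =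
      (blockUnionCount (Fintype.card G) (orderOf ψ) n : ℂ) := by
  have orderOf_eq : orderOf ψ.toMonoidHom = orderOf ψ :=
    (AddChar.toMonoidHomMulEquiv (A := G) (M := ℂ)).orderOf_eq ψ
  have orderOf_pos : 0 < orderOf ψ := orderOf_pos ψ
  have ψ_sum (S : Finset G) : ψ (∑ x ∈ S, x) = ∏ x ∈ S, ψ x :=
    map_prod ψ.toMonoidHom (fun x => Multiplicative.ofAdd x) S
  simp_rw [ψ_sum]
  rw [← coeff_prod_one_add_C_mul_X, blockUnionCount, ← coeff_one_sub_neg_X_pow hn orderOf_pos,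
    ← orderOf_eq]
  have prod_eq := prod_one_add_C_monoidHom_mul_X ψ.toMonoidHom
    (Complex.isPrimitiveRoot_exp _ (orderOf_eq ▸ orderOf_pos.ne'))
  rw [Fintype.card_multiplicative] at prod_eq
  rw [← prod_eq]
  exact congrArg (coeff · n) (Fintype.prod_equiv Multiplicative.ofAdd _ _ fun x => rfl)

theorem card_mul_card_sum_eq_zero {n : ℕ} (hn : Odd n) :
    Nat.card {S : Set.powersetCard G n // ∑ x ∈ S.1, x = 0} * Nat.card G =
      ∑ t : G, blockUnionCount (Nat.card G) (addOrderOf t) n := by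
  classical
  rw [← sum_addChar_orderOf fun d => blockUnionCount (Nat.card G) d n]
  suffices (Nat.card {S : Set.powersetCard G n // ∑ x ∈ S.1, x = 0} * Nat.card G : ℂ) =
      ∑ ψ : AddChar G ℂ, (blockUnionCount (Nat.card G) (orderOf ψ) n : ℂ) by exact_mod_cast this
  simp_rw [Nat.card_eq_fintype_card, ← sum_powersetCard_addChar_sum hn]
  rw [sum_comm]
  simp_rw [AddChar.sum_apply_eq_ite]
  simp only [sum_ite, sum_const_zero, add_zero, sum_const, Fintype.card_subtype, nsmul_eq_mul]

end

theorem card_finset_mul_card_eq {α : Type*} [Finite α] {d : ℕ} (hd : 0 < d) (n : ℕ) :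
    Nat.card {T : Finset α // d * #T = n} = blockUnionCount (d * Nat.card α) d n := by
  rw [blockUnionCount, Nat.mul_div_cancel_left _ hd]
  split_ifs with hdn
  · obtain ⟨k, rfl⟩ := hdn
    rw [Nat.mul_div_cancel_left _ hd, ← Set.powersetCard.card]
    exact Nat.card_congr (Equiv.subtypeEquivRight fun T => by
      rw [Set.powersetCard.mem_iff, Nat.mul_right_inj hd.ne'])
  · have : IsEmpty {T : Finset α // d * #T = n} := ⟨fun T => hdn ⟨_, T.2.symm⟩⟩
    exact Nat.card_of_isEmpty

section Burnside

variable {G : Type*} [AddCommGroup G] [Finite G]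

/-- The union of a finite set of cosets of `H`, as a finset of the ambient group. -/
def cosetUnion (H : AddSubgroup G) (T : Finset (G ⧸ H)) : Finset G :=
  (Set.toFinite {x : G | (x : G ⧸ H) ∈ T}).toFinset

theorem mem_cosetUnion {H : AddSubgroup G} {T : Finset (G ⧸ H)} {x : G} :
    x ∈ cosetUnion H T ↔ (x : G ⧸ H) ∈ T := by
  simp [cosetUnion]

theorem cosetUnion_injective (H : AddSubgroup G) : Function.Injective (cosetUnion H) := by
  intro T T' h
  ext c
  obtain ⟨x, rfl⟩ := QuotientAddGroup.mk_surjective c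
  rw [← mem_cosetUnion, h, mem_cosetUnion]

theorem card_cosetUnion (H : AddSubgroup G) (T : Finset (G ⧸ H)) :
    #(cosetUnion H T) = Nat.card H * #T := by
  have coe_eq : (cosetUnion H T : Set G) = QuotientAddGroup.mk ⁻¹' (T : Set (G ⧸ H)) := by
    ext
    simp [mem_cosetUnion]
  rw [← Set.ncard_coe_finset, coe_eq, ← Nat.card_coe_set_eq,
    Nat.card_congr (QuotientAddGroup.preimageMkEquivAddSubgroupProdSet H T), Nat.card_prod,
    Nat.card_coe_set_eq, Set.ncard_coe_finset]

variable [DecidableEq G]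

theorem le_stabilizer_iff_exists_cosetUnion {H : AddSubgroup G} {S : Finset G} :
    H ≤ AddAction.stabilizer G S ↔ ∃ T, cosetUnion H T = S := by
  classical
  constructor
  · refine fun hS => ⟨S.image (fun x : G => (x : G ⧸ H)), Finset.ext fun x => ?_⟩
    rw [mem_cosetUnion, mem_image]
    refine ⟨?_, fun hx => ⟨x, hx, rfl⟩⟩
    rintro ⟨y, hy, hyx⟩
    have vadd_eq : (x - y) +ᵥ S = S :=
      hS (by simpa [neg_add_eq_sub] using QuotientAddGroup.eq.1 hyx)
    simpa [vadd_eq] using vadd_mem_vadd_finset (a := x - y) hy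
  · rintro ⟨T, rfl⟩ h hh
    ext x
    have mk_eq : ((-h +ᵥ x : G) : G ⧸ H) = x := by
      rw [QuotientAddGroup.eq]
      simpa using hh
    rw [← neg_vadd_mem_iff, mem_cosetUnion, mem_cosetUnion, mk_eq]

theorem card_fixedBy_powersetCard (t : G) (n : ℕ) :
    Nat.card (AddAction.fixedBy (Set.powersetCard G n) t) =
      blockUnionCount (Nat.card G) (addOrderOf t) n := by
  let H := AddSubgroup.zmultiples t
  have fixedBy_iff (S : Set.powersetCard G n) :
      S ∈ AddAction.fixedBy (Set.powersetCard G n) t ↔ ∃ T, cosetUnion H T = S := by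
    rw [← le_stabilizer_iff_exists_cosetUnion, AddSubgroup.zmultiples_le,
      AddAction.mem_stabilizer_iff, AddAction.mem_fixedBy, Subtype.ext_iff]
    rfl
  let toFixedBy (T : {T : Finset (G ⧸ H) // addOrderOf t * #T = n}) :
      AddAction.fixedBy (Set.powersetCard G n) t :=
    ⟨Set.powersetCard.ofCard (s := cosetUnion H T)
      (by rw [card_cosetUnion, Nat.card_zmultiples, T.2]), (fixedBy_iff _).2 ⟨T, rfl⟩⟩
  have toFixedBy_bijective : Function.Bijective toFixedBy := by
    refine ⟨fun T T' h => Subtype.ext (cosetUnion_injective H (congrArg (·.1.1) h)), fun S => ?_⟩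
    obtain ⟨T, hT⟩ := (fixedBy_iff _).1 S.2
    exact ⟨⟨T, by rw [← Nat.card_zmultiples, ← card_cosetUnion, hT, S.1.2]⟩,
      Subtype.ext (Subtype.ext hT)⟩
  rw [← Nat.card_eq_of_bijective toFixedBy toFixedBy_bijective,
    card_finset_mul_card_eq (addOrderOf_pos t), ← Nat.card_zmultiples, ← AddSubgroup.index,
    AddSubgroup.card_mul_index]

theorem card_orbits_powersetCard_mul_card [Fintype G] (n : ℕ) :
    Nat.card (AddAction.orbitRel.Quotient G (Set.powersetCard G n)) * Nat.card G =
      ∑ t : G, blockUnionCount (Nat.card G) (addOrderOf t) n := by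
  simp_rw [← card_fixedBy_powersetCard]
  rw [← Nat.card_prod, ← Nat.card_sigma]
  exact (Nat.card_congr (AddAction.sigmaFixedByEquivOrbitsProdAddGroup G _)).symm

theorem card_sum_eq_zero_eq_card_orbits {n : ℕ} (hn : Odd n) :
    Nat.card {S : Set.powersetCard G n // ∑ x ∈ S.1, x = 0} =
      Nat.card (AddAction.orbitRel.Quotient G (Set.powersetCard G n)) := by
  have := Fintype.ofFinite G
  refine Nat.eq_of_mul_eq_mul_right (Nat.card_pos (α := G)) ?_
  rw [card_mul_card_sum_eq_zero hn, card_orbits_powersetCard_mul_card]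

end Burnside

section Necklace

variable {q : ℕ}

/-- The binary word recording which residues belong to a subset of `ZMod q`, starting at `0`. -/
def toWord (S : Finset (ZMod q)) : List Bool :=
  List.ofFn fun i : Fin q => decide (((i : ℕ) : ZMod q) ∈ S)

theorem length_toWord (S : Finset (ZMod q)) : (toWord S).length = q := by
  simp [toWord]

theorem getElem_toWord (S : Finset (ZMod q)) (i : ℕ) (h : i < (toWord S).length) :
    (toWord S)[i] = decide ((i : ZMod q) ∈ S) := by
  simp [toWord]

theorem rotate_toWord (S : Finset (ZMod q)) (k : ℕ) :
    (toWord S).rotate k = toWord (-(k : ZMod q) +ᵥ S) := by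
  refine List.ext_getElem (by simp [length_toWord]) fun i _ _ => ?_
  rw [List.getElem_rotate, getElem_toWord, getElem_toWord, length_toWord, decide_eq_decide,
    mem_neg_vadd_finset_iff, ZMod.natCast_mod, vadd_eq_add, add_comm, Nat.cast_add]

variable [NeZero q]

theorem toWord_injective : Function.Injective (toWord (q := q)) := by
  intro S S' h
  ext x
  have getElem_eq : (toWord S)[x.val]'(by simpa [length_toWord] using x.val_lt) =
      (toWord S')[x.val]'(by simpa [length_toWord] using x.val_lt) := by simp only [h]
  simpa [getElem_toWord] using getElem_eq

theorem toWord_isRotated_iff {S S' : Finset (ZMod q)} :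
    toWord S ~r toWord S' ↔ ∃ t : ZMod q, t +ᵥ S = S' := by
  constructor
  · rintro ⟨k, hk⟩
    exact ⟨_, toWord_injective ((rotate_toWord S k).symm.trans hk)⟩
  · rintro ⟨t, rfl⟩
    exact ⟨(-t).val, by rw [rotate_toWord, ZMod.natCast_zmod_val, neg_neg]⟩

theorem count_true_toWord (S : Finset (ZMod q)) : (toWord S).count true = #S := by
  have natCast_bijective : Function.Bijective fun i : Fin q => ((i : ℕ) : ZMod q) :=
    (Fintype.bijective_iff_surjective_and_card _).2
      ⟨fun x => ⟨⟨x.val, x.val_lt⟩, ZMod.natCast_zmod_val x⟩, by simp [ZMod.card]⟩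
  rw [← Multiset.coe_count, toWord, ← Fin.univ_val_map, Multiset.count_map]
  exact card_bijective (s := {i : Fin q | true = decide (((i : ℕ) : ZMod q) ∈ S)}) _
    natCast_bijective (by simp)

theorem exists_toWord_eq {l : List Bool} (hl : l.length = q) :
    ∃ S : Finset (ZMod q), toWord S = l := by
  refine ⟨univ.filter fun x => l.getD x.val false = true, ?_⟩
  refine List.ext_getElem (by rw [length_toWord, hl]) fun i _ hi => ?_
  simp [getElem_toWord, ZMod.val_cast_of_lt (hl ▸ hi), hi]

theorem coe_toWord_mem_necklaces (S : Finset (ZMod q)) :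
    (toWord S : Cycle Bool) ∈ necklaces #S (q - #S) := by
  have count_add := List.count_not_add_count (toWord S) true
  rw [length_toWord, count_true_toWord, Bool.not_true] at count_add
  refine ⟨?_, ?_⟩ <;> rw [Cycle.coe_toMultiset, Multiset.coe_count]
  · exact count_true_toWord S
  · exact Nat.eq_sub_of_add_eq count_add

theorem exists_toWord_eq_of_mem_necklaces {n : ℕ} (hn : n ≤ q) {c : Cycle Bool}
    (hc : c ∈ necklaces n (q - n)) :
    ∃ S : Finset (ZMod q), #S = n ∧ (toWord S : Cycle Bool) = c := by
  obtain ⟨l, rfl⟩ : ∃ l : List Bool, (l : Cycle Bool) = c := Quotient.exists_rep c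
  obtain ⟨count_true, count_false⟩ := hc
  rw [Cycle.coe_toMultiset, Multiset.coe_count] at count_true count_false
  have length_eq := List.count_not_add_count l true
  rw [count_true, Bool.not_true, count_false, Nat.sub_add_cancel hn] at length_eq
  obtain ⟨S, rfl⟩ := exists_toWord_eq length_eq.symm
  exact ⟨S, by rw [← count_true_toWord, count_true], rfl⟩

theorem ncard_necklaces {n : ℕ} (hn : n ≤ q) :
    (necklaces n (q - n)).ncard =
      Nat.card (AddAction.orbitRel.Quotient (ZMod q) (Set.powersetCard (ZMod q) n)) := by
  let toCycle (S : Set.powersetCard (ZMod q) n) : Cycle Bool := toWord S.1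
  have orbitRel_eq_ker :
      AddAction.orbitRel (ZMod q) (Set.powersetCard (ZMod q) n) = Setoid.ker toCycle := by
    ext S S'
    rw [AddAction.orbitRel_apply, AddAction.mem_orbit_iff, Setoid.ker_def, Cycle.coe_eq_coe,
      List.isRotated_comm, toWord_isRotated_iff]
    exact exists_congr fun t => Subtype.ext_iff
  have range_toCycle : Set.range toCycle = necklaces n (q - n) := by
    refine Set.Subset.antisymm ?_ fun c hc => ?_
    · rintro _ ⟨S, rfl⟩
      simpa using coe_toWord_mem_necklaces S.1
    · obtain ⟨S, hS, rfl⟩ := exists_toWord_eq_of_mem_necklaces hn hc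
      exact ⟨⟨S, hS⟩, rfl⟩
  rw [← range_toCycle, AddAction.orbitRel.Quotient, orbitRel_eq_ker,
    Nat.card_congr (Setoid.quotientKerEquivRange toCycle), Nat.card_coe_set_eq]

end Necklace

end ArithTutte

end

theorem theorem1p13 (n q : ℕ) (hn : Odd n) (hq : 0 < q) (hnq : n ∣ q) :
    (((ArithTutte.charPolyWeightA n).eval (q : ℤ) : ℤ) : ℚ) / (n.factorial : ℚ) =
      ((ArithTutte.necklaces n (q - n)).ncard : ℚ) := by
  have : NeZero q := ⟨hq.ne'⟩
  have : NeZero n := ⟨hn.pos.ne'⟩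
  have eval_eq : (ArithTutte.charPolyWeightA n).eval (q : ℤ) =
      (n.factorial * (ArithTutte.necklaces n (q - n)).ncard : ℕ) := by
    rw [ArithTutte.charPolyWeightA,
      ArithTutte.eval_arithmeticCharPoly_eq_card ArithTutte.positiveRootsA_mem
        (ArithTutte.killsTorsion_positiveRootsA hnq),
      ArithTutte.card_hom_root_ne_zero, ArithTutte.card_embedding_sum_eq_zero,
      ArithTutte.card_sum_eq_zero_eq_card_orbits hn,
      ArithTutte.ncard_necklaces (Nat.le_of_dvd hq hnq)]
  rw [eval_eq, Int.cast_natCast, Nat.cast_mul,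
    mul_div_cancel_left₀ _ (Nat.cast_ne_zero.2 n.factorial_ne_zero)]
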